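/- **Definitions.** Let $Q$ be a loop with neutral element $1$; write $L_x(y)=xy$, $R_x(y)=yx$, $x\backslash y=L_x^{-1}(y)$, $y/x=R_x^{-1}(y)$. Let $\mathrm{Mlt}(Q)=\langle L_x,R_x : x\in Q\rangle$ and $\mathrm{Inn}(Q)=\{\varphi\in\mathrm{Mlt}(Q):\varphi(1)=1\}$. A subloop is normal if it is the kernel of a loop homomorphism. For $x,y,z\in Q$ put $[y,x]=((yx)/y)/x$ and $[x,y,z]=(((xy)z)/(yz))/x$. A word $W$ is a formal product of letters $L_t$, $R_t$ and their inverses, where the $t=t(x_1,\dots,x_n)$ are loop terms; substituting $\bar u=(u_1,\dots,u_n)\in Q^n$ gives $W_{\bar u}\in\mathrm{Mlt}(Q)$. The word $W$ is inner if $W_{\bar u}(1)=1$ in every loop and for every assignment $\bar u$. For congruences $\alpha,\beta$ of $Q$, the commutator $[\alpha,\beta]$ is the smallest congruence $\delta$ such that for every loop term $t(\bar x,\bar y)$ and all tuples with $a_i\mathrel{\alpha}b_i$ and $u_j\mathrel{\beta}v_j$, $t(\bar a,\bar u)\mathrel{\delta}t(\bar a,\bar v)$ implies $t(\bar b,\bar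 u)\mathrel{\delta}t(\bar b,\bar v)$. For normal subloops $A,B$ of $Q$, $[A,B]_Q$ is the normal subloop corresponding to the commutator of the congruences of $A$ and $B$ (where $x,y$ are congruent modulo $A$ iff $x/y\in A$). For a commutative group $(A,+)$ and a loop $F$, a loop cocycle is a triple $(\varphi,\psi,\theta)$ of maps $\varphi,\psi:F\times F\to\mathrm{Aut}(A)$, $\theta:F\times F\to A$ with $\varphi_{y,1}=\mathrm{id}=\psi_{1,y}$ and $\theta_{1,y}=0=\theta_{y,1}$ for all $y\in F$. The abelian extension of $A$ by $F$ over it is the loop on $A\times F$ with multiplication $(a,x)(b,y)=(\varphi_{x,y}(a)+\psi_{x,y}(b)+\theta_{x,y},\,xy)$ and neutral element $(0,1)$. **Theorem.** For a normal subloop $A$ of a loop $Q$ the following conditions are equivalent: (A1) $A$ is abelian in $Q$, that is, $[A,A]_Q=1$. (A2) $W_{\bar u}W_{\bar v}^{-1}|_A=\mathrm{id}_A$ for every inner word $W$ and all $u_i,v_i\in Q$ with $u_i/v_i\in A$ for every $i$. (A3) $\varphi|_A\in\mathrm{Aut}(A)$ for every $\varphi\in\mathrm{Inn}(Q)$; and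 $[a,b]=[a,b,x]=[a,x,b]=[x,a,b]=1$ and $[a,x,u]=[a,x,v]$ for all $a,b\in A$ and $x,u,v\in Q$ with $u/v\in A$. (A4) $Q$ is an abelian extension of $A$ by $Q/A$: $A$ is a commutative group, and there are a loop cocycle of $Q/A$ in $A$ and an isomorphism $f$ from the abelian extension of $A$ by $Q/A$ over it onto $Q$ such that $f(a,1)=a$ and $f(a,x)$ lies in the coset $x$, for all $a\in A$ and $x\in Q/A$. -/

import Mathlib

universe u v

namespace LoopTheory

/-- A loop: a quasigroup with a neutral element. The laws of the two divisions say exactly that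
all translations `y ↦ x * y` and `y ↦ y * x` are bijections, with inverses `ldiv x` (left
division) and `(· / x)` (right division). -/
class Loop (Q : Type u) extends MulOneClass Q, Div Q where
  ldiv : Q → Q → Q
  mul_ldiv : ∀ x y : Q, x * ldiv x y = y
  ldiv_mul : ∀ x y : Q, ldiv x (x * y) = y
  div_mul : ∀ x y : Q, (y / x) * x = y
  mul_div : ∀ x y : Q, (y * x) / x = y

open Loop (ldiv)

theorem Loop.right_cancel {Q : Type u} [Loop Q] {x y z : Q} (h : y * x = z * x) : y = z := by
  rw [← Loop.mul_div x y, h, Loop.mul_div]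

theorem Loop.left_cancel {Q : Type u} [Loop Q] {x y z : Q} (h : x * y = x * z) : y = z := by
  rw [← Loop.ldiv_mul x y, h, Loop.ldiv_mul]

/-- Homomorphisms of loops preserve right division. -/
theorem hom_div {Q : Type u} {P : Type v} [Loop Q] [Loop P] (f : Q →* P) (x y : Q) :
    f (x / y) = f x / f y := by
  apply Loop.right_cancel (x := f y)
  rw [← map_mul, Loop.div_mul, Loop.div_mul]

/-- Homomorphisms of loops preserve left division. -/
theorem hom_ldiv {Q : Type u} {P : Type v} [Loop Q] [Loop P] (f : Q →* P) (x y : Q) :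
    f (ldiv x y) = ldiv (f x) (f y) := by
  apply Loop.left_cancel (x := f x)
  rw [← map_mul, Loop.mul_ldiv, Loop.mul_ldiv]

theorem div_eq_one_iff_loop {Q : Type u} [Loop Q] (x y : Q) : x / y = 1 ↔ x = y := by
  constructor
  · intro h
    have := Loop.div_mul y x
    rw [h, one_mul] at this
    exact this.symm
  · rintro rfl
    have := Loop.mul_div x (1 : Q)
    rwa [one_mul] at this

/-! ### Translations, multiplication group, inner mapping group -/

/-- The left translation `L_x : y ↦ x * y`. -/
def leftTr {Q : Type u} [Loop Q] (x : Q) : Equiv.Perm Q where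
  toFun y := x * y
  invFun y := ldiv x y
  left_inv y := Loop.ldiv_mul x y
  right_inv y := Loop.mul_ldiv x y

/-- The right translation `R_x : y ↦ y * x`. -/
def rightTr {Q : Type u} [Loop Q] (x : Q) : Equiv.Perm Q where
  toFun y := y * x
  invFun y := y / x
  left_inv y := Loop.mul_div x y
  right_inv y := Loop.div_mul x y

/-- The multiplication group `Mlt(Q)`. -/
def mlt (Q : Type u) [Loop Q] : Subgroup (Equiv.Perm Q) :=
  Subgroup.closure (Set.range leftTr ∪ Set.range rightTr)

/-- The inner mapping group `Inn(Q)`: the stabilizer of `1` in `Mlt(Q)`. -/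
def inn (Q : Type u) [Loop Q] : Subgroup (Equiv.Perm Q) :=
  mlt Q ⊓ MulAction.stabilizer (Equiv.Perm Q) (1 : Q)

/-! ### Terms and words -/

/-- Loop terms with variables in `X`. -/
inductive LoopTerm (X : Type) : Type
  | var : X → LoopTerm X
  | one : LoopTerm X
  | mul : LoopTerm X → LoopTerm X → LoopTerm X
  | ldiv : LoopTerm X → LoopTerm X → LoopTerm X
  | rdiv : LoopTerm X → LoopTerm X → LoopTerm X

/-- The value of a term in a loop under an assignment of the variables. -/
def LoopTerm.eval {X : Type} {Q : Type u} [Loop Q] (w : X → Q) : LoopTerm X → Q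
  | .var i => w i
  | .one => 1
  | .mul s t => s.eval w * t.eval w
  | .ldiv s t => Loop.ldiv (s.eval w) (t.eval w)
  | .rdiv s t => s.eval w / t.eval w

/-- The letters `L_t`, `R_t`, `L_t⁻¹`, `R_t⁻¹`, where `t` is a loop term. -/
inductive Letter (X : Type) : Type
  | L : LoopTerm X → Letter X
  | R : LoopTerm X → Letter X
  | Linv : LoopTerm X → Letter X
  | Rinv : LoopTerm X → Letter X

def Letter.eval {X : Type} {Q : Type u} [Loop Q] (w : X → Q) : Letter X → Equiv.Perm Q
  | .L t => leftTr (t.eval w)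
  | .R t => rightTr (t.eval w)
  | .Linv t => (leftTr (t.eval w))⁻¹
  | .Rinv t => (rightTr (t.eval w))⁻¹

/-- A word is a formal product of letters. -/
abbrev Word (X : Type) : Type := List (Letter X)

/-- `W_w`, the element of `Mlt(Q)` obtained from the word `W` by substituting `w i` for the
variable `i` (the product of permutations is composition). -/
def Word.eval {X : Type} {Q : Type u} [Loop Q] (W : Word X) (w : X → Q) : Equiv.Perm Q :=
  (List.map (Letter.eval w) W).prod

/-- `W` is an inner word: `W_w(1) = 1` in every loop and for every assignment. (This is an
identity, hence the condition does not depend on the universe in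
which the loops are taken.) -/
def Word.IsInner {X : Type} (W : Word X) : Prop :=
  ∀ (P : Type u) [Loop P] (w : X → P), W.eval w 1 = 1

/-! ### Commutators and associators of elements -/

/-- `[y, x] = ((y x) / y) / x`. -/
def elemComm {Q : Type u} [Loop Q] (y x : Q) : Q := ((y * x) / y) / x

/-- `[x, y, z] = (((x y) z) / (y z)) / x`. -/
def elemAssoc {Q : Type u} [Loop Q] (x y z : Q) : Q := (((x * y) * z) / (y * z)) / x

/-! ### Subloops and congruences -/

structure Subloop (Q : Type u) [Loop Q] where
  carrier : Set Q
  one_mem' : 1 ∈ carrier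
  mul_mem' : ∀ {x y}, x ∈ carrier → y ∈ carrier → x * y ∈ carrier
  ldiv_mem' : ∀ {x y}, x ∈ carrier → y ∈ carrier → ldiv x y ∈ carrier
  div_mem' : ∀ {x y}, x ∈ carrier → y ∈ carrier → x / y ∈ carrier

instance Subloop.instSetLike {Q : Type u} [Loop Q] : SetLike (Subloop Q) Q where
  coe A := A.carrier
  coe_injective A B h := by cases A; cases B; congr

/-- The trivial subloop `{1}`. -/
instance Subloop.instBot {Q : Type u} [Loop Q] : Bot (Subloop Q) where
  bot :=
    { carrier := {1}
      one_mem' := rfl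
      mul_mem' := by
        rintro x y rfl rfl
        exact one_mul _
      ldiv_mem' := by
        rintro x y rfl rfl
        have := Loop.ldiv_mul (1 : Q) 1
        rwa [one_mul] at this
      div_mem' := by
        rintro x y rfl rfl
        exact (div_eq_one_iff_loop _ _).2 rfl }

instance Subloop.instLoop {Q : Type u} [Loop Q] (A : Subloop Q) : Loop A where
  one := ⟨1, A.one_mem'⟩
  mul a b := ⟨a.1 * b.1, A.mul_mem' a.2 b.2⟩
  div a b := ⟨a.1 / b.1, A.div_mem' a.2 b.2⟩
  ldiv a b := ⟨ldiv a.1 b.1, A.ldiv_mem' a.2 b.2⟩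
  one_mul a := Subtype.ext (one_mul a.1)
  mul_one a := Subtype.ext (mul_one a.1)
  mul_ldiv a b := Subtype.ext (Loop.mul_ldiv a.1 b.1)
  ldiv_mul a b := Subtype.ext (Loop.ldiv_mul a.1 b.1)
  div_mul a b := Subtype.ext (Loop.div_mul a.1 b.1)
  mul_div a b := Subtype.ext (Loop.mul_div a.1 b.1)

/-- A subloop is normal if it is the kernel of a homomorphism of loops. -/
def Subloop.IsNormal {Q : Type u} [Loop Q] (A : Subloop Q) : Prop :=
  ∃ (P : Type u) (_ : Loop P) (f : Q →* P), ∀ x : Q, x ∈ A ↔ f x = 1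

/-- Congruences of a loop (compatible with all three binary operations). -/
structure LoopCon (Q : Type u) [Loop Q] extends Setoid Q where
  mul' : ∀ {x y z t : Q}, r x y → r z t → r (x * z) (y * t)
  ldiv' : ∀ {x y z t : Q}, r x y → r z t → r (ldiv x z) (ldiv y t)
  div' : ∀ {x y z t : Q}, r x y → r z t → r (x / z) (y / t)

/-- The congruence of a normal subloop `A`: `x` and `y` are related iff `x / y ∈ A`. -/
def Subloop.con {Q : Type u} [Loop Q] (A : Subloop Q) (hA : A.IsNormal) : LoopCon Q :=
  have key : ∃ (P : Type u) (_ : Loop P) (f : Q →* P), ∀ x y : Q, x / y ∈ A ↔ f x = f y := by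
    obtain ⟨P, iP, f, hf⟩ := hA
    exact ⟨P, iP, f, fun x y => by rw [hf, hom_div, div_eq_one_iff_loop]⟩
  { r := fun x y => x / y ∈ A
    iseqv := by
      obtain ⟨P, iP, f, hf⟩ := key
      simp only [hf]
      exact ⟨fun _ => rfl, fun h => h.symm, fun h k => h.trans k⟩
    mul' := by
      obtain ⟨P, iP, f, hf⟩ := key
      simp only [hf, map_mul]
      intro x y z t h k
      rw [h, k]
    ldiv' := by
      obtain ⟨P, iP, f, hf⟩ := key
      simp only [hf, hom_ldiv]
      intro x y z t h k
      rw [h, k]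
    div' := by
      obtain ⟨P, iP, f, hf⟩ := key
      simp only [hf, hom_div]
      intro x y z t h k
      rw [h, k] }

/-- The normal subloop of a congruence: the class of `1`. -/
def LoopCon.subloop {Q : Type u} [Loop Q] (α : LoopCon Q) : Subloop Q where
  carrier := {x | α.r x 1}
  one_mem' := α.iseqv.refl 1
  mul_mem' {x y} hx hy := by
    have := α.mul' hx hy
    rwa [one_mul] at this
  ldiv_mem' {x y} hx hy := by
    have := α.ldiv' hx hy
    have h1 := Loop.ldiv_mul (1 : Q) 1
    rw [one_mul] at h1
    rwa [h1] at this
  div_mem' {x y} hx hy := by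
    have := α.div' hx hy
    rwa [(div_eq_one_iff_loop (1 : Q) 1).2 rfl] at this

/-- The quotient loop modulo a congruence. -/
def LoopCon.Quot {Q : Type u} [Loop Q] (α : LoopCon Q) : Type u := Quotient α.toSetoid

/-- The class of an element. -/
def LoopCon.toQuot {Q : Type u} [Loop Q] (α : LoopCon Q) (x : Q) : α.Quot := Quotient.mk α.toSetoid x

instance LoopCon.instLoopQuot {Q : Type u} [Loop Q] (α : LoopCon Q) : Loop α.Quot where
  one := α.toQuot 1
  mul := Quotient.map₂ (· * ·) (fun _ _ h _ _ k => α.mul' h k)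
  div := Quotient.map₂ (· / ·) (fun _ _ h _ _ k => α.div' h k)
  ldiv := Quotient.map₂ ldiv (fun _ _ h _ _ k => α.ldiv' h k)
  one_mul := by
    rintro ⟨x⟩
    exact congrArg α.toQuot (one_mul x)
  mul_one := by
    rintro ⟨x⟩
    exact congrArg α.toQuot (mul_one x)
  mul_ldiv := by
    rintro ⟨x⟩ ⟨y⟩
    exact congrArg α.toQuot (Loop.mul_ldiv x y)
  ldiv_mul := by
    rintro ⟨x⟩ ⟨y⟩
    exact congrArg α.toQuot (Loop.ldiv_mul x y)
  div_mul := by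
    rintro ⟨x⟩ ⟨y⟩
    exact congrArg α.toQuot (Loop.div_mul x y)
  mul_div := by
    rintro ⟨x⟩ ⟨y⟩
    exact congrArg α.toQuot (Loop.mul_div x y)

/-- The factor loop `Q/A` of a loop by a normal subloop. -/
abbrev Subloop.Factor {Q : Type u} [Loop Q] (A : Subloop Q) (hA : A.IsNormal) : Type u :=
  (A.con hA).Quot

/-! ### The Freese–McKenzie commutator -/

/-- `C(α, β; δ)`, the term condition: `α` centralizes `β` modulo `δ`. -/
def LoopCon.Centralizes {Q : Type u} [Loop Q] (α β δ : LoopCon Q) : Prop :=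
  ∀ (m n : ℕ) (t : LoopTerm (Fin m ⊕ Fin n)) (a b : Fin m → Q) (w z : Fin n → Q),
    (∀ i, α.r (a i) (b i)) → (∀ j, β.r (w j) (z j)) →
    δ.r (t.eval (Sum.elim a w)) (t.eval (Sum.elim a z)) →
    δ.r (t.eval (Sum.elim b w)) (t.eval (Sum.elim b z))

/-- The commutator `[α, β]` of two congruences: the smallest congruence `δ` such that
`C(α, β; δ)`, constructed as the intersection of all of them. -/
def LoopCon.commutator {Q : Type u} [Loop Q] (α β : LoopCon Q) : LoopCon Q where
  r x y := ∀ δ : LoopCon Q, α.Centralizes β δ → δ.r x y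
  iseqv :=
    ⟨fun x δ _ => δ.iseqv.refl x, fun h δ hδ => δ.iseqv.symm (h δ hδ),
      fun h k δ hδ => δ.iseqv.trans (h δ hδ) (k δ hδ)⟩
  mul' h k δ hδ := δ.mul' (h δ hδ) (k δ hδ)
  ldiv' h k δ hδ := δ.ldiv' (h δ hδ) (k δ hδ)
  div' h k δ hδ := δ.div' (h δ hδ) (k δ hδ)

/-- The intersection does satisfy the term condition, so it is the smallest such congruence. -/
theorem LoopCon.centralizes_commutator {Q : Type u} [Loop Q] (α β : LoopCon Q) :
    α.Centralizes β (α.commutator β) :=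
  fun m n t a b w z hab hwz h δ hδ => hδ m n t a b w z hab hwz (h δ hδ)

/-- The commutator `[A, B]_Q` of two normal subloops: the normal subloop that corresponds to the
commutator of the congruences of `A` and `B`. -/
def Subloop.commutator {Q : Type u} [Loop Q] (A B : Subloop Q) (hA : A.IsNormal)
    (hB : B.IsNormal) : Subloop Q :=
  ((A.con hA).commutator (B.con hB)).subloop

/-! ### Abelian extensions -/

/-- A loop cocycle `(φ, ψ, θ)` of a loop `F` in a commutative group `A`. -/
structure LoopCocycle (A : Type u) (F : Type v) [AddCommGroup A] [Loop F] where
  φ : F → F → A ≃+ A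
  ψ : F → F → A ≃+ A
  θ : F → F → A
  φ_one : ∀ y, φ y 1 = AddEquiv.refl A
  ψ_one : ∀ y, ψ 1 y = AddEquiv.refl A
  θ_one_left : ∀ y, θ 1 y = 0
  θ_one_right : ∀ y, θ y 1 = 0

/-- The underlying set `A × F` of the abelian extension of `A` by `F` over `Γ`. -/
def LoopCocycle.Ext {A : Type u} {F : Type v} [AddCommGroup A] [Loop F]
    (_Γ : LoopCocycle A F) : Type (max u v) := A × F

/-- The abelian extension of `A` by `F` over `Γ`, with the multiplication
`(a, x) (b, y) = (φ_{x,y}(a) + ψ_{x,y}(b) + θ_{x,y}, x y)`. -/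
instance LoopCocycle.instLoopExt {A : Type u} {F : Type v} [AddCommGroup A] [Loop F]
    (Γ : LoopCocycle A F) : Loop Γ.Ext where
  one := ((0, 1) : A × F)
  mul p q := ((Γ.φ p.2 q.2 p.1 + Γ.ψ p.2 q.2 q.1 + Γ.θ p.2 q.2, p.2 * q.2) : A × F)
  div p q :=
    (((Γ.φ (p.2 / q.2) q.2).symm
      (p.1 - Γ.ψ (p.2 / q.2) q.2 q.1 - Γ.θ (p.2 / q.2) q.2), p.2 / q.2) : A × F)
  ldiv p q :=
    (((Γ.ψ p.2 (ldiv p.2 q.2)).symm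
      (q.1 - Γ.φ p.2 (ldiv p.2 q.2) p.1 - Γ.θ p.2 (ldiv p.2 q.2)), ldiv p.2 q.2) : A × F)
  one_mul := by
    rintro ⟨a, x⟩
    change ((Γ.φ 1 x 0 + Γ.ψ 1 x a + Γ.θ 1 x, 1 * x) : A × F) = (a, x)
    simp [Γ.ψ_one, Γ.θ_one_left]
  mul_one := by
    rintro ⟨a, x⟩
    change ((Γ.φ x 1 a + Γ.ψ x 1 0 + Γ.θ x 1, x * 1) : A × F) = (a, x)
    simp [Γ.φ_one, Γ.θ_one_right]
  mul_ldiv := by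
    rintro ⟨a, x⟩ ⟨b, y⟩
    change ((Γ.φ x (ldiv x y) a + Γ.ψ x (ldiv x y) ((Γ.ψ x (ldiv x y)).symm
      (b - Γ.φ x (ldiv x y) a - Γ.θ x (ldiv x y))) + Γ.θ x (ldiv x y),
        x * ldiv x y) : A × F) = (b, y)
    rw [AddEquiv.apply_symm_apply, Loop.mul_ldiv]
    congr 1
    abel
  ldiv_mul := by
    rintro ⟨a, x⟩ ⟨b, y⟩
    change (((Γ.ψ x (ldiv x (x * y))).symm
      (Γ.φ x y a + Γ.ψ x y b + Γ.θ x y - Γ.φ x (ldiv x (x * y)) a - Γ.θ x (ldiv x (x * y))),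
        ldiv x (x * y)) : A × F) = (b, y)
    rw [Loop.ldiv_mul, add_sub_right_comm, add_sub_cancel_right, add_sub_cancel_left,
      AddEquiv.symm_apply_apply]
  div_mul := by
    rintro ⟨b, y⟩ ⟨a, x⟩
    change ((Γ.φ (x / y) y ((Γ.φ (x / y) y).symm (a - Γ.ψ (x / y) y b - Γ.θ (x / y) y))
      + Γ.ψ (x / y) y b + Γ.θ (x / y) y, x / y * y) : A × F) = (a, x)
    rw [AddEquiv.apply_symm_apply, Loop.div_mul]
    congr 1
    abel
  mul_div := by
    rintro ⟨b, y⟩ ⟨a, x⟩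
    change (((Γ.φ (x * y / y) y).symm
      (Γ.φ x y a + Γ.ψ x y b + Γ.θ x y - Γ.ψ (x * y / y) y b - Γ.θ (x * y / y) y),
        x * y / y) : A × F) = (a, x)
    rw [Loop.mul_div, sub_right_comm, add_sub_cancel_right, add_sub_cancel_right,
      AddEquiv.symm_apply_apply]

/-- A loop is a commutative group. -/
def IsCommGroup (A : Type u) [Loop A] : Prop :=
  (∀ a b c : A, (a * b) * c = a * (b * c)) ∧ ∀ a b : A, a * b = b * a

/-- The commutative group with the given loop operations. -/
abbrev IsCommGroup.commGroup {A : Type u} [Loop A] (h : IsCommGroup A) : CommGroup A where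
  mul_assoc := h.1
  one_mul := one_mul
  mul_one := mul_one
  inv a := 1 / a
  div_eq_mul_inv a b := by
    apply Loop.right_cancel (x := b)
    rw [Loop.div_mul, h.1, Loop.div_mul, mul_one]
  inv_mul_cancel a := Loop.div_mul a 1
  mul_comm := h.2

/-- `Q` is an abelian extension of its normal subloop `A` by `Q/A`: `A` is a commutative group,
and there are a loop cocycle `Γ` and an isomorphism from the abelian extension of `A` by `Q/A`
over `Γ` onto `Q` that identifies `A × 1` with `A` and the projection onto the second coordinate
with the natural projection `Q → Q/A`. -/
def IsAbelianExtension {Q : Type u} [Loop Q] (A : Subloop Q) (hA : A.IsNormal) : Prop :=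
  ∃ h : IsCommGroup A,
    letI : CommGroup A := h.commGroup
    ∃ (Γ : LoopCocycle (Additive A) (A.Factor hA)) (f : Γ.Ext ≃* Q),
      (∀ a : A, f (Additive.ofMul a, 1) = a) ∧
      ∀ (a : A) (x : A.Factor hA), (A.con hA).toQuot (f (Additive.ofMul a, x)) = x

end LoopTheory

open LoopTheory

namespace LoopTheory

/-! The implications run in a cycle.

(A1) to (A2): an inner word is a term `t(x, ū) = W_ū(x)` with `t(1, ū) = 1`. The term condition
moves the equality of values at `x = 1` to `x = a` (`word_eval_apply_eq_of_centralizes`).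

(A2) to (A3): parameters lying in `A` may be replaced by `1`, where the basic inner mappings
collapse, which gives the commutator and associator identities. Applied to `y ↦ W(x₀) \ W(x₀y)`, the
same replacement makes inner mappings multiplicative on `A` (`InnerWordsAgree.inn_map_mul`).

(A3) to (A4): with coset representatives `l x`, `l 1 = 1`, every element is uniquely `a * l x`. The
product `(a * l x) * (b * l y)` is brought to this form by two inner mappings, which serve as `φ`
and `ψ`; `θ` compares `l x * l y` with `l (x * y)` (`isAbelianExtension_of_inn`).

(A4) to (A1): in an abelian extension every term is affine in the `A`-coordinates, with coefficients
given by the `F`-coordinates (`LoopCocycle.exists_affine_eval`). So a change of one group of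
variables alters the value by an amount independent of the other group, which is the term condition.
-/

theorem Loop.div_one {Q : Type u} [Loop Q] (x : Q) : x / 1 = x := by
  have := Loop.mul_div (1 : Q) x
  rwa [mul_one] at this

theorem Loop.one_ldiv {Q : Type u} [Loop Q] (x : Q) : Loop.ldiv 1 x = x := by
  have := Loop.ldiv_mul (1 : Q) x
  rwa [one_mul] at this

theorem Loop.ldiv_self {Q : Type u} [Loop Q] (x : Q) : Loop.ldiv x x = 1 := by
  have := Loop.ldiv_mul x (1 : Q)
  rwa [mul_one] at this

theorem Loop.div_self {Q : Type u} [Loop Q] (x : Q) : x / x = 1 :=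
  (div_eq_one_iff_loop x x).2 rfl

theorem Loop.div_eq_iff {Q : Type u} [Loop Q] {x y z : Q} : x / y = z ↔ x = z * y := by
  constructor
  · rintro rfl
    rw [Loop.div_mul]
  · rintro rfl
    rw [Loop.mul_div]

theorem Loop.ldiv_eq_iff {Q : Type u} [Loop Q] {x y z : Q} : Loop.ldiv x y = z ↔ y = x * z := by
  constructor
  · rintro rfl
    rw [Loop.mul_ldiv]
  · rintro rfl
    rw [Loop.ldiv_mul]

theorem elemComm_eq_one_iff {Q : Type u} [Loop Q] {y x : Q} :
    elemComm y x = 1 ↔ y * x = x * y := by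
  rw [elemComm, div_eq_one_iff_loop, Loop.div_eq_iff]

theorem elemAssoc_eq_one_iff {Q : Type u} [Loop Q] {x y z : Q} :
    elemAssoc x y z = 1 ↔ (x * y) * z = x * (y * z) := by
  rw [elemAssoc, div_eq_one_iff_loop, Loop.div_eq_iff]

/-! ### Multiplication group and normal subloops -/

theorem perm_apply_inv_apply {X : Type u} (φ : Equiv.Perm X) (x : X) : φ (φ⁻¹ x) = x :=
  φ.apply_symm_apply x

theorem perm_inv_apply_apply {X : Type u} (φ : Equiv.Perm X) (x : X) : φ⁻¹ (φ x) = x :=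
  φ.symm_apply_apply x

theorem leftTr_mem_mlt {Q : Type u} [Loop Q] (x : Q) : leftTr x ∈ mlt Q :=
  Subgroup.subset_closure (Or.inl ⟨x, rfl⟩)

theorem rightTr_mem_mlt {Q : Type u} [Loop Q] (x : Q) : rightTr x ∈ mlt Q :=
  Subgroup.subset_closure (Or.inr ⟨x, rfl⟩)

theorem mem_inn_iff {Q : Type u} [Loop Q] {φ : Equiv.Perm Q} :
    φ ∈ inn Q ↔ φ ∈ mlt Q ∧ φ 1 = 1 := Iff.rfl

theorem Letter.eval_mem_mlt {X : Type} {Q : Type u} [Loop Q] (w : X → Q) (l : Letter X) :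
    l.eval w ∈ mlt Q := by
  cases l
  · exact leftTr_mem_mlt _
  · exact rightTr_mem_mlt _
  · exact inv_mem (leftTr_mem_mlt _)
  · exact inv_mem (rightTr_mem_mlt _)

theorem Word.eval_mem_mlt {X : Type} {Q : Type u} [Loop Q] (w : X → Q) (W : Word X) :
    W.eval w ∈ mlt Q :=
  list_prod_mem fun x hx => by
    obtain ⟨l, -, rfl⟩ := List.mem_map.1 hx
    exact l.eval_mem_mlt w

/-- Elements of the multiplication group respect the fibres of every homomorphism. -/
theorem mlt_map_eq_iff {Q : Type u} {P : Type v} [Loop Q] [Loop P] (f : Q →* P)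
    {φ : Equiv.Perm Q} (hφ : φ ∈ mlt Q) : ∀ x y : Q, f (φ x) = f (φ y) ↔ f x = f y := by
  induction hφ using Subgroup.closure_induction with
  | mem g hg =>
    intro x y
    rcases hg with ⟨q, rfl⟩ | ⟨q, rfl⟩
    · change f (q * x) = f (q * y) ↔ _
      rw [map_mul, map_mul]
      exact ⟨Loop.left_cancel, fun h => by rw [h]⟩
    · change f (x * q) = f (y * q) ↔ _
      rw [map_mul, map_mul]
      exact ⟨Loop.right_cancel, fun h => by rw [h]⟩
  | one => exact fun _ _ => Iff.rfl
  | mul g h _ _ ihg ihh => exact fun x y => (ihg _ _).trans (ihh _ _)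
  | inv g _ ih =>
    intro x y
    rw [← ih, perm_apply_inv_apply, perm_apply_inv_apply]

/-- `A` is the fibre over `1` of a homomorphism; elements of `Mlt(Q)` permute the fibres, and an
inner mapping fixes `1`. -/
theorem inn_mem_iff {Q : Type u} [Loop Q] {A : Subloop Q} (hA : A.IsNormal)
    {φ : Equiv.Perm Q} (hφ : φ ∈ inn Q) (x : Q) : φ x ∈ A ↔ x ∈ A := by
  obtain ⟨P, _, f, hf⟩ := hA
  obtain ⟨h, h1⟩ := mem_inn_iff.1 hφ
  have := mlt_map_eq_iff f h x 1
  rwa [h1, map_one, ← hf, ← hf] at this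

theorem inn_apply_mem {Q : Type u} [Loop Q] {A : Subloop Q} (hA : A.IsNormal)
    {φ : Equiv.Perm Q} (hφ : φ ∈ inn Q) (a : A) : φ a ∈ A :=
  (inn_mem_iff hA hφ a).2 a.2

/-- An inner mapping that is multiplicative on a normal subloop restricts to an automorphism. -/
theorem exists_mulEquiv_of_inn {Q : Type u} [Loop Q] {A : Subloop Q} (hA : A.IsNormal)
    {φ : Equiv.Perm Q} (hφ : φ ∈ inn Q) (h : ∀ a ∈ A, ∀ b ∈ A, φ (a * b) = φ a * φ b) :
    ∃ ψ : A ≃* A, ∀ a : A, (ψ a : Q) = φ a :=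
  ⟨{ toFun := fun a => ⟨φ a, inn_apply_mem hA hφ a⟩
     invFun := fun a => ⟨φ⁻¹ a, inn_apply_mem hA (inv_mem hφ) a⟩
     left_inv := fun a => Subtype.ext (Equiv.symm_apply_apply φ (a : Q))
     right_inv := fun a => Subtype.ext (Equiv.apply_symm_apply φ (a : Q))
     map_mul' := fun a b => Subtype.ext (h a a.2 b b.2) }, fun _ => rfl⟩

/-! ### Terms and words -/

/-- Renaming of the variables of a term. -/
def LoopTerm.rename {X Y : Type} (s : X → Y) : LoopTerm X → LoopTerm Y
  | .var i => .var (s i)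
  | .one => .one
  | .mul t r => .mul (t.rename s) (r.rename s)
  | .ldiv t r => .ldiv (t.rename s) (r.rename s)
  | .rdiv t r => .rdiv (t.rename s) (r.rename s)

theorem LoopTerm.eval_rename {X Y : Type} {Q : Type u} [Loop Q] (s : X → Y) (w : Y → Q)
    (t : LoopTerm X) : (t.rename s).eval w = t.eval (w ∘ s) := by
  induction t <;> simp_all [LoopTerm.rename, LoopTerm.eval]

theorem LoopTerm.map_eval {X : Type} {Q : Type u} {P : Type v} [Loop Q] [Loop P] (f : Q →* P)
    (w : X → Q) (t : LoopTerm X) : f (t.eval w) = t.eval (f ∘ w) := by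
  induction t <;> simp_all [LoopTerm.eval, hom_div, hom_ldiv]

/-- The term obtained by applying a letter, with renamed variables, to a term. -/
def Letter.apply {X Y : Type} (s : X → Y) : Letter X → LoopTerm Y → LoopTerm Y
  | .L t, r => .mul (t.rename s) r
  | .R t, r => .mul r (t.rename s)
  | .Linv t, r => .ldiv (t.rename s) r
  | .Rinv t, r => .rdiv r (t.rename s)

theorem Letter.eval_apply {X Y : Type} {Q : Type u} [Loop Q] (s : X → Y) (w : Y → Q)
    (l : Letter X) (r : LoopTerm Y) : (l.apply s r).eval w = l.eval (w ∘ s) (r.eval w) := by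
  cases l <;> simp only [Letter.apply, LoopTerm.eval, LoopTerm.eval_rename] <;> rfl

/-- The term obtained by applying a word, with renamed variables, to a term. -/
def Word.apply {X Y : Type} (s : X → Y) (W : Word X) (r : LoopTerm Y) : LoopTerm Y :=
  W.foldr (Letter.apply s) r

theorem Word.eval_cons {X : Type} {Q : Type u} [Loop Q] (w : X → Q) (l : Letter X) (W : Word X) :
    Word.eval (l :: W) w = l.eval w * W.eval w := by
  simp [Word.eval]

theorem Word.eval_append {X : Type} {Q : Type u} [Loop Q] (w : X → Q) (V W : Word X) :
    Word.eval (V ++ W) w = V.eval w * W.eval w := by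
  simp [Word.eval]

theorem Word.eval_apply {X Y : Type} {Q : Type u} [Loop Q] (s : X → Y) (w : Y → Q)
    (W : Word X) (r : LoopTerm Y) : (W.apply s r).eval w = W.eval (w ∘ s) (r.eval w) := by
  induction W with
  | nil => rfl
  | cons l W ih =>
    rw [Word.eval_cons, Equiv.Perm.mul_apply, ← ih, ← Letter.eval_apply]
    rfl

/-- Every element of the multiplication group is the value of a word that leaves the variable `0`
unused. -/
theorem exists_word_of_mem_mlt {Q : Type u} [Loop Q] {φ : Equiv.Perm Q} (hφ : φ ∈ mlt Q) :
    ∃ (n : ℕ) (W : Word (Fin (n + 1))) (w : Fin n → Q),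
      ∀ q : Q, W.eval (Fin.cons q w : Fin (n + 1) → Q) = φ := by
  rw [mlt, ← Subgroup.mem_toSubmonoid, Subgroup.closure_toSubmonoid] at hφ
  obtain ⟨l, hl, rfl⟩ := Submonoid.exists_list_of_mem_closure hφ
  -- Each factor of the product gets its own variable `i.succ`. Variable `0` stays free to serve as
  -- the base point in `innerShift`.
  have key : ∀ i : Fin l.length, ∃ (x : Q) (K : Letter (Fin (l.length + 1))),
      ∀ w : Fin (l.length + 1) → Q, w i.succ = x → K.eval w = l.get i := by
    intro i
    rcases hl (l.get i) (List.get_mem l i) with (⟨x, hx⟩ | ⟨x, hx⟩) | (⟨x, hx⟩ | ⟨x, hx⟩)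
    · exact ⟨x, .L (.var i.succ), fun w hw => by
        simp only [Letter.eval, LoopTerm.eval, hw, hx]⟩
    · exact ⟨x, .R (.var i.succ), fun w hw => by
        simp only [Letter.eval, LoopTerm.eval, hw, hx]⟩
    · exact ⟨x, .Linv (.var i.succ), fun w hw => by
        simp only [Letter.eval, LoopTerm.eval, hw, hx, inv_inv]⟩
    · exact ⟨x, .Rinv (.var i.succ), fun w hw => by
        simp only [Letter.eval, LoopTerm.eval, hw, hx, inv_inv]⟩
  choose w K hK using key
  refine ⟨l.length, List.ofFn K, w, fun q => ?_⟩
  rw [Word.eval, List.map_ofFn]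
  congr 1
  refine Eq.trans ?_ (List.ofFn_get l)
  congr 1
  funext i
  exact hK i _ (Fin.cons_succ (α := fun _ => Q) q w i)

/-! ### The term condition -/

/-- The equality congruence. -/
def LoopCon.equality (Q : Type u) [Loop Q] : LoopCon Q where
  r x y := x = y
  iseqv := eq_equivalence
  mul' h k := by rw [h, k]
  ldiv' h k := by rw [h, k]
  div' h k := by rw [h, k]

/-- A loop congruence is determined by its class of `1`, since `x ≡ y` yields `x / y ≡ 1`. -/
theorem LoopCon.r_iff_eq_of_subloop_eq_bot {Q : Type u} [Loop Q] {α : LoopCon Q}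
    (h : α.subloop = ⊥) {x y : Q} : α.r x y ↔ x = y := by
  constructor
  · intro hxy
    have h1 : x / y ∈ α.subloop := by
      have := α.div' hxy (α.iseqv.refl y)
      rwa [Loop.div_self y] at this
    rw [h] at h1
    exact (div_eq_one_iff_loop x y).1 h1
  · rintro rfl
    exact α.iseqv.refl x

/-- The commutator itself satisfies the term condition, and if its class of `1` is trivial it is
equality. Conversely, if equality satisfies the condition, it is one of the congruences being
intersected. -/
theorem Subloop.commutator_eq_bot_iff {Q : Type u} [Loop Q] {A B : Subloop Q} (hA : A.IsNormal)
    (hB : B.IsNormal) : A.commutator B hA hB = ⊥ ↔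
      (A.con hA).Centralizes (B.con hB) (LoopCon.equality Q) := by
  constructor
  · intro h m n t a b w z hab hwz e
    have e' := (LoopCon.r_iff_eq_of_subloop_eq_bot h).2 e
    exact (LoopCon.r_iff_eq_of_subloop_eq_bot h).1
      (LoopCon.centralizes_commutator _ _ m n t a b w z hab hwz e')
  · intro h
    refine SetLike.ext fun x => ⟨fun hx => show x = 1 from (show ∀ _, _ from hx) _ h, fun hx => ?_⟩
    rw [show x = 1 from hx]
    exact Subloop.one_mem' _

/-- If `A` is abelian in `Q`, then the restriction to `A` of the value of an inner word depends
only on the classes modulo `A` of the parameters. -/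
theorem word_eval_apply_eq_of_centralizes {Q : Type u} [Loop Q] {A : Subloop Q}
    (hA : A.IsNormal) (h : (A.con hA).Centralizes (A.con hA) (LoopCon.equality Q))
    {n : ℕ} {W : Word (Fin n)} (hW : Word.IsInner.{u} W) {w z : Fin n → Q}
    (hwz : ∀ i, w i / z i ∈ A) {a : Q} (ha : a ∈ A) : W.eval w a = W.eval z a := by
  have := h 1 n (W.apply Sum.inr (.var (Sum.inl 0))) (fun _ => 1) (fun _ => a) w z
    (fun _ => (A.con hA).iseqv.symm (by
      change a / 1 ∈ A
      rwa [Loop.div_one])) hwz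
  rw [Word.eval_apply, Word.eval_apply, Word.eval_apply, Word.eval_apply] at this
  refine this ?_
  change W.eval w 1 = W.eval z 1
  rw [hW, hW]

/-! ### Inner words -/

/-- The word of the inner mappings `T_x = R_x⁻¹ L_x`. -/
def innerT : Word (Fin 1) := [.Rinv (.var 0), .L (.var 0)]

/-- The word of the inner mappings `R_{x,y} = R_{xy}⁻¹ R_y R_x`. -/
def innerR : Word (Fin 2) := [.Rinv (.mul (.var 0) (.var 1)), .R (.var 1), .R (.var 0)]

/-- The word of the inner mappings `L_{xy}⁻¹ L_x L_y`. -/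
def innerL : Word (Fin 2) := [.Linv (.mul (.var 0) (.var 1)), .L (.var 0), .L (.var 1)]

/-- The word of the inner mappings `y ↦ W(x₀) \ W(x₀ y)`. -/
def innerShift {n : ℕ} (W : Word (Fin (n + 1))) : Word (Fin (n + 1)) :=
  .Linv (W.apply id (.var 0)) :: (W ++ [.L (.var 0)])

theorem innerT_eval {Q : Type u} [Loop Q] (w : Fin 1 → Q) (q : Q) :
    innerT.eval w q = (w 0 * q) / w 0 := rfl

theorem innerR_eval {Q : Type u} [Loop Q] (w : Fin 2 → Q) (q : Q) :
    innerR.eval w q = ((q * w 0) * w 1) / (w 0 * w 1) := rfl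

theorem innerL_eval {Q : Type u} [Loop Q] (w : Fin 2 → Q) (q : Q) :
    innerL.eval w q = Loop.ldiv (w 0 * w 1) (w 0 * (w 1 * q)) := rfl

theorem innerShift_eval {Q : Type u} [Loop Q] {n : ℕ} (W : Word (Fin (n + 1)))
    (w : Fin (n + 1) → Q) (q : Q) :
    (innerShift W).eval w q = Loop.ldiv (W.eval w (w 0)) (W.eval w (w 0 * q)) := by
  rw [innerShift, Word.eval_cons, Word.eval_append, Letter.eval, Word.eval_apply]
  rfl

theorem innerT_isInner : Word.IsInner.{u} innerT := fun P _ w => by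
  rw [innerT_eval, mul_one, Loop.div_self]

theorem innerR_isInner : Word.IsInner.{u} innerR := fun P _ w => by
  rw [innerR_eval, one_mul, Loop.div_self]

theorem innerL_isInner : Word.IsInner.{u} innerL := fun P _ w => by
  rw [innerL_eval, mul_one, Loop.ldiv_self]

theorem innerShift_isInner {n : ℕ} (W : Word (Fin (n + 1))) : Word.IsInner.{u} (innerShift W) :=
  fun P _ w => by rw [innerShift_eval, mul_one, Loop.ldiv_self]

/-- Inner words agree on `A` at assignments that are congruent modulo `A`. -/
def InnerWordsAgree {Q : Type u} [Loop Q] (A : Subloop Q) : Prop :=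
  ∀ (n : ℕ) (W : Word (Fin n)), Word.IsInner.{u} W → ∀ w z : Fin n → Q, (∀ i, w i / z i ∈ A) →
    ∀ a ∈ A, W.eval w a = W.eval z a

theorem word_eval_mem_inn {Q : Type u} [Loop Q] {n : ℕ} {W : Word (Fin n)}
    (hW : Word.IsInner.{u} W) (w : Fin n → Q) : W.eval w ∈ inn Q :=
  mem_inn_iff.2 ⟨W.eval_mem_mlt w, hW Q w⟩

/-- `W_z` maps `A` onto itself, so the quotient of the two permutations fixes `A` pointwise exactly
when they agree on `A`. -/
theorem innerWordsAgree_iff {Q : Type u} [Loop Q] {A : Subloop Q} (hA : A.IsNormal) :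
    InnerWordsAgree A ↔
      ∀ (n : ℕ) (W : Word (Fin n)), Word.IsInner.{u} W → ∀ w z : Fin n → Q,
        (∀ i, w i / z i ∈ A) → ∀ a ∈ A, (W.eval w * (W.eval z)⁻¹) a = a := by
  refine forall₃_congr fun n W hW => forall₃_congr fun w z _ => ⟨fun h a ha => ?_, fun h a ha => ?_⟩
  · rw [Equiv.Perm.mul_apply, h _ ((inn_mem_iff hA (inv_mem (word_eval_mem_inn hW z)) a).2 ha),
      perm_apply_inv_apply]
  · have := h (W.eval z a) ((inn_mem_iff hA (word_eval_mem_inn hW z) a).2 ha)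
    rwa [Equiv.Perm.mul_apply, perm_inv_apply_apply] at this

/-! ### Element identities from agreement of inner words -/

section InnerWordsAgree

variable {Q : Type u} [Loop Q] {A : Subloop Q}

theorem InnerWordsAgree.mul_div_mul_eq (h : InnerWordsAgree A) {a x y w z : Q} (ha : a ∈ A)
    (hxy : x / y ∈ A) (hwz : w / z ∈ A) :
    ((a * x) * w) / (x * w) = ((a * y) * z) / (y * z) :=
  h 2 innerR innerR_isInner ![x, w] ![y, z]
    (fun i => by fin_cases i; exacts [hxy, hwz]) a ha

theorem Subloop.div_self_mem (A : Subloop Q) (x : Q) : x / x ∈ A := by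
  rw [Loop.div_self]
  exact A.one_mem'

theorem Subloop.div_one_mem {a : Q} (ha : a ∈ A) : a / 1 ∈ A := by
  rwa [Loop.div_one]

/-- On `A` the mapping `T_a` agrees with `T_1`, the identity. -/
theorem InnerWordsAgree.elemComm_eq_one (h : InnerWordsAgree A) {a b : Q} (ha : a ∈ A)
    (hb : b ∈ A) : elemComm a b = 1 := by
  have := h 1 innerT innerT_isInner (fun _ => a) (fun _ => 1) (fun _ => A.div_one_mem ha) b hb
  rw [innerT_eval, innerT_eval, one_mul, Loop.div_one] at this
  rw [elemComm, this, Loop.div_self]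

theorem InnerWordsAgree.elemAssoc_eq (h : InnerWordsAgree A) {a x y w z : Q} (ha : a ∈ A)
    (hxy : x / y ∈ A) (hwz : w / z ∈ A) : elemAssoc a x w = elemAssoc a y z := by
  rw [elemAssoc, elemAssoc, h.mul_div_mul_eq ha hxy hwz]

theorem InnerWordsAgree.elemAssoc_left_eq_one (h : InnerWordsAgree A) {a b : Q} (ha : a ∈ A)
    (hb : b ∈ A) (x : Q) : elemAssoc a b x = 1 := by
  rw [h.elemAssoc_eq ha (A.div_one_mem hb) (A.div_self_mem x), elemAssoc_eq_one_iff, mul_one,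
    one_mul]

theorem InnerWordsAgree.elemAssoc_outer_eq_one (h : InnerWordsAgree A) {a b : Q} (ha : a ∈ A)
    (hb : b ∈ A) (x : Q) : elemAssoc a x b = 1 := by
  rw [h.elemAssoc_eq ha (A.div_self_mem x) (A.div_one_mem hb), elemAssoc_eq_one_iff, mul_one,
    mul_one]

/-- Here the first entry `x` is arbitrary, so `innerL`, which acts on the last entry `b ∈ A`,
replaces `innerR`; its parameter `a` is moved to `1`. -/
theorem InnerWordsAgree.elemAssoc_right_eq_one (h : InnerWordsAgree A) {a b : Q} (ha : a ∈ A)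
    (hb : b ∈ A) (x : Q) : elemAssoc x a b = 1 := by
  have : Loop.ldiv (x * a) (x * (a * b)) = Loop.ldiv (x * 1) (x * (1 * b)) :=
    h 2 innerL innerL_isInner ![x, a] ![x, 1]
      (fun i => by fin_cases i; exacts [A.div_self_mem x, A.div_one_mem ha]) b hb
  rw [mul_one, one_mul, Loop.ldiv_mul, Loop.ldiv_eq_iff] at this
  rw [elemAssoc_eq_one_iff, this]

theorem InnerWordsAgree.inn_map_mul (h : InnerWordsAgree A) {φ : Equiv.Perm Q}
    (hφ : φ ∈ inn Q) {a b : Q} (ha : a ∈ A) (hb : b ∈ A) : φ (a * b) = φ a * φ b := by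
  obtain ⟨h1, h2⟩ := mem_inn_iff.1 hφ
  obtain ⟨n, W, w, hw⟩ := exists_word_of_mem_mlt h1
  -- Only the base point moves, from `a` to `1`, and `W` still evaluates to `φ`: this yields `φ a \
  -- φ (a * b) = φ 1 \ φ (1 * b) = φ b`.
  have := h (n + 1) (innerShift W) (innerShift_isInner W) (Fin.cons a w) (Fin.cons 1 w)
    (fun i => by
      refine Fin.cases ?_ (fun i => ?_) i
      · exact A.div_one_mem ha
      · exact A.div_self_mem (w i)) b hb
  rw [innerShift_eval, innerShift_eval, hw, hw] at this
  simp only [Fin.cons_zero] at this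
  rwa [h2, one_mul, Loop.one_ldiv, Loop.ldiv_eq_iff] at this

end InnerWordsAgree

/-! ### Construction of the cocycle -/

section Construction

variable {Q : Type u} [Loop Q]

/-- The inner mapping `R_{xy}⁻¹ R_y R_x`. -/
def innerMapR (x y : Q) : Equiv.Perm Q := (rightTr (x * y))⁻¹ * (rightTr y * rightTr x)

/-- The inner mapping `R_{xy}⁻¹ L_x R_y`. -/
def innerMapM (x y : Q) : Equiv.Perm Q := (rightTr (x * y))⁻¹ * (leftTr x * rightTr y)

theorem innerMapR_apply (x y q : Q) : innerMapR x y q = ((q * x) * y) / (x * y) := rfl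

theorem innerMapM_apply (x y q : Q) : innerMapM x y q = (x * (q * y)) / (x * y) := rfl

theorem innerMapR_mem_inn (x y : Q) : innerMapR x y ∈ inn Q :=
  mem_inn_iff.2 ⟨mul_mem (inv_mem (rightTr_mem_mlt _))
    (mul_mem (rightTr_mem_mlt _) (rightTr_mem_mlt _)), by
    rw [innerMapR_apply, one_mul, Loop.div_self]⟩

theorem innerMapM_mem_inn (x y : Q) : innerMapM x y ∈ inn Q :=
  mem_inn_iff.2 ⟨mul_mem (inv_mem (rightTr_mem_mlt _))
    (mul_mem (leftTr_mem_mlt _) (rightTr_mem_mlt _)), by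
    rw [innerMapM_apply, one_mul, Loop.div_self]⟩

theorem LoopCon.toQuot_mul (α : LoopCon Q) (x y : Q) :
    α.toQuot (x * y) = α.toQuot x * α.toQuot y := rfl

theorem LoopCon.toQuot_eq_iff (α : LoopCon Q) {x y : Q} : α.toQuot x = α.toQuot y ↔ α.r x y :=
  Quotient.eq

/-- The normalization `l 1 = 1` is what makes the cocycle conditions at `1` hold. -/
theorem LoopCon.exists_section (α : LoopCon Q) :
    ∃ l : α.Quot → Q, (∀ x, α.toQuot (l x) = x) ∧ l 1 = 1 := by
  classical
  refine ⟨Function.update (Function.surjInv (f := α.toQuot) Quotient.mk_surjective) 1 1,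
    fun x => ?_, Function.update_self _ _ _⟩
  by_cases hx : x = 1
  · subst hx
    rw [Function.update_self]
    rfl
  · rw [Function.update_of_ne hx]
    exact Function.surjInv_eq _ _

theorem Subloop.toQuot_eq_iff {A : Subloop Q} (hA : A.IsNormal) {x y : Q} :
    (A.con hA).toQuot x = (A.con hA).toQuot y ↔ x / y ∈ A :=
  LoopCon.toQuot_eq_iff _

theorem Subloop.toQuot_of_mem {A : Subloop Q} (hA : A.IsNormal) {a : Q} (ha : a ∈ A) :
    (A.con hA).toQuot a = 1 :=
  (A.toQuot_eq_iff hA).2 (A.div_one_mem ha)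

theorem isAbelianExtension_of_inn {A : Subloop Q} (hA : A.IsNormal)
    (hinn : ∀ φ ∈ inn Q, ∃ ψ : A ≃* A, ∀ a : A, (ψ a : Q) = φ a)
    (hcomm : ∀ a ∈ A, ∀ b ∈ A, a * b = b * a)
    (hassoc : ∀ a ∈ A, ∀ b ∈ A, ∀ x : Q, (a * b) * x = a * (b * x))
    (hR : ∀ a ∈ A, ∀ x w z : Q, w / z ∈ A → innerMapR x w a = innerMapR x z a) :
    IsAbelianExtension A hA := by
  have hgrp : IsCommGroup A :=
    ⟨fun a b c => Subtype.ext (hassoc a a.2 b b.2 c), fun a b => Subtype.ext (hcomm a a.2 b b.2)⟩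
  refine ⟨hgrp, ?_⟩
  let : CommGroup A := hgrp.commGroup
  obtain ⟨l, hl, hl1⟩ := (A.con hA).exists_section
  choose ρ hρ using hinn
  have hθ : ∀ x y, (l x * l y) / l (x * y) ∈ A := fun x y => by
    rw [← A.toQuot_eq_iff hA, LoopCon.toQuot_mul, hl, hl, hl]
  let Γ : LoopCocycle (Additive A) (A.Factor hA) :=
    { φ := fun x y => MulEquiv.toAdditive (ρ _ (innerMapR_mem_inn (l x) (l y)))
      ψ := fun x y => MulEquiv.toAdditive (ρ _ (innerMapM_mem_inn (l x) (l y)))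
      θ := fun x y => Additive.ofMul ⟨(l x * l y) / l (x * y), hθ x y⟩
      φ_one := fun y => by
        ext a
        change (ρ _ (innerMapR_mem_inn (l y) (l 1)) a.toMul : Q) = _
        rw [hρ, hl1, innerMapR_apply, mul_one, mul_one, Loop.mul_div]
        rfl
      ψ_one := fun y => by
        ext a
        change (ρ _ (innerMapM_mem_inn (l 1) (l y)) a.toMul : Q) = _
        rw [hρ, hl1, innerMapM_apply, one_mul, one_mul, Loop.mul_div]
        rfl
      θ_one_left := fun y => Subtype.ext (by
        change (l 1 * l y) / l (1 * y) = 1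
        rw [hl1, one_mul, one_mul, Loop.div_self])
      θ_one_right := fun y => Subtype.ext (by
        change (l y * l 1) / l (y * 1) = 1
        rw [hl1, mul_one, mul_one, Loop.div_self]) }
  have hcoset : ∀ (a : A) (x : A.Factor hA), (A.con hA).toQuot (a * l x) = x := fun a x => by
    rw [LoopCon.toQuot_mul, A.toQuot_of_mem hA a.2, hl, one_mul]
  have hdiv : ∀ q, q / l ((A.con hA).toQuot q) ∈ A := fun q => by
    rw [← A.toQuot_eq_iff hA, hl]
  let f : Γ.Ext ≃* Q :=
    { toFun := fun p => (p.1.toMul : Q) * l p.2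
      invFun := fun q => (Additive.ofMul ⟨q / l ((A.con hA).toQuot q), hdiv q⟩,
        (A.con hA).toQuot q)
      left_inv := fun p => by
        refine Prod.ext (Subtype.ext ?_) (hcoset _ _)
        change (p.1.toMul * l p.2 : Q) / l ((A.con hA).toQuot (p.1.toMul * l p.2)) = p.1.toMul
        rw [hcoset, Loop.mul_div]
      right_inv := fun q => Loop.div_mul _ q
      map_mul' := by
        rintro ⟨a, x⟩ ⟨b, y⟩
        -- Write `R` and `M` for `innerMapR (l x) (l y)` and `innerMapM (l x) (l y)`. Reassociating,
        -- the left side is `R a * (M b * (l x * l y)) = R a * (l x * (b * l y))`. Since `b * l y`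
        -- and `l y` are congruent modulo `A`, `hR` replaces `R` by `innerMapR (l x) (b * l y)`, and
        -- the right side results.
        change (((ρ _ (innerMapR_mem_inn (l x) (l y)) a.toMul : A) : Q) *
          (ρ _ (innerMapM_mem_inn (l x) (l y)) b.toMul : A) *
          ((l x * l y) / l (x * y))) * l (x * y) = (a.toMul * l x) * (b.toMul * l y)
        have ha := A.mul_mem' (ρ _ (innerMapR_mem_inn (l x) (l y)) a.toMul).2
          (ρ _ (innerMapM_mem_inn (l x) (l y)) b.toMul).2
        rw [hassoc _ ha _ (hθ x y), Loop.div_mul, hassoc _ (Subtype.property _) _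
          (Subtype.property _), hρ, hρ, innerMapM_apply, Loop.div_mul,
          ← hR _ (Subtype.property _) (l x) (b.toMul * l y) (l y) (by
            rw [Loop.mul_div]; exact Subtype.property _), innerMapR_apply, Loop.div_mul] }
  refine ⟨Γ, f, fun a => ?_, hcoset⟩
  change (a : Q) * l 1 = a
  rw [hl1, mul_one]

end Construction

/-! ### Terms in abelian extensions -/

section Extension

variable {A : Type u} {F : Type v} [AddCommGroup A] [Loop F] (Γ : LoopCocycle A F)

/-- The element of an abelian extension with the given coordinates. -/
def LoopCocycle.pair (a : A) (x : F) : Γ.Ext := (a, x)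

theorem LoopCocycle.pair_mul_pair (a b : A) (x y : F) :
    Γ.pair a x * Γ.pair b y = Γ.pair (Γ.φ x y a + Γ.ψ x y b + Γ.θ x y) (x * y) := rfl

theorem LoopCocycle.pair_div_pair (a b : A) (x y : F) :
    Γ.pair a x / Γ.pair b y =
      Γ.pair ((Γ.φ (x / y) y).symm (a - Γ.ψ (x / y) y b - Γ.θ (x / y) y)) (x / y) := rfl

theorem LoopCocycle.pair_ldiv_pair (a b : A) (x y : F) :
    Loop.ldiv (Γ.pair a x) (Γ.pair b y) =
      Γ.pair ((Γ.ψ x (Loop.ldiv x y)).symm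
        (b - Γ.φ x (Loop.ldiv x y) a - Γ.θ x (Loop.ldiv x y))) (Loop.ldiv x y) := rfl

/-- In an abelian extension of `A` by `F`, the value of a term is an affine function of the
`A`-coordinates, whose coefficients depend only on the `F`-coordinates. -/
theorem LoopCocycle.exists_affine_eval {X : Type} (p : X → F) (t : LoopTerm X) :
    ∃ (L : (X → A) →+ A) (c : A), ∀ a : X → A,
      t.eval (fun i => Γ.pair (a i) (p i)) = Γ.pair (L a + c) (t.eval p) := by
  induction t with
  | var i =>
    refine ⟨Pi.evalAddMonoidHom _ i, 0, fun a => ?_⟩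
    rw [add_zero]
    rfl
  | one =>
    refine ⟨0, 0, fun a => ?_⟩
    rw [add_zero]
    rfl
  | mul s t ihs iht =>
    obtain ⟨L, c, hL⟩ := ihs
    obtain ⟨M, d, hM⟩ := iht
    simp only [LoopTerm.eval, hL, hM, Γ.pair_mul_pair]
    generalize s.eval p = x
    generalize t.eval p = y
    refine ⟨(Γ.φ x y : A →+ A).comp L + (Γ.ψ x y : A →+ A).comp M,
      Γ.φ x y c + Γ.ψ x y d + Γ.θ x y, fun a => congrArg (Γ.pair · _) ?_⟩
    simp only [map_add, AddMonoidHom.add_apply, AddMonoidHom.comp_apply, AddMonoidHom.coe_coe]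
    abel
  | ldiv s t ihs iht =>
    obtain ⟨L, c, hL⟩ := ihs
    obtain ⟨M, d, hM⟩ := iht
    simp only [LoopTerm.eval, hL, hM, Γ.pair_ldiv_pair]
    generalize s.eval p = x
    generalize Loop.ldiv x (t.eval p) = y
    refine ⟨((Γ.ψ x y).symm : A →+ A).comp (M - (Γ.φ x y : A →+ A).comp L),
      (Γ.ψ x y).symm (d - Γ.φ x y c - Γ.θ x y), fun a => congrArg (Γ.pair · _) ?_⟩
    simp only [map_add, map_sub, AddMonoidHom.sub_apply, AddMonoidHom.comp_apply,
      AddMonoidHom.coe_coe]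
    abel
  | rdiv s t ihs iht =>
    obtain ⟨L, c, hL⟩ := ihs
    obtain ⟨M, d, hM⟩ := iht
    simp only [LoopTerm.eval, hL, hM, Γ.pair_div_pair]
    generalize t.eval p = y
    generalize s.eval p / y = x
    refine ⟨((Γ.φ x y).symm : A →+ A).comp (L - (Γ.ψ x y : A →+ A).comp M),
      (Γ.φ x y).symm (c - Γ.ψ x y d - Γ.θ x y), fun a => congrArg (Γ.pair · _) ?_⟩
    simp only [map_add, map_sub, AddMonoidHom.sub_apply, AddMonoidHom.comp_apply,
      AddMonoidHom.coe_coe]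
    abel

/-- The term condition for the kernel of the projection of an abelian extension. -/
theorem LoopCocycle.term_condition {X Y : Type} (t : LoopTerm (X ⊕ Y)) (a b : X → Γ.Ext) (w z : Y → Γ.Ext)
    (hab : ∀ i, (a i).2 = (b i).2) (hwz : ∀ j, (w j).2 = (z j).2)
    (h : t.eval (Sum.elim a w) = t.eval (Sum.elim a z)) :
    t.eval (Sum.elim b w) = t.eval (Sum.elim b z) := by
  obtain ⟨L, c, hL⟩ := Γ.exists_affine_eval
    (Sum.elim (fun i => (a i).2) (fun j => (w j).2)) t
  have key : ∀ (a' : X → Γ.Ext) (w' : Y → Γ.Ext), (∀ i, (a i).2 = (a' i).2) →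
      (∀ j, (w j).2 = (w' j).2) → t.eval (Sum.elim a' w') =
        Γ.pair (L (Sum.elim (fun i => (a' i).1) (fun j => (w' j).1)) + c)
          (t.eval (Sum.elim (fun i => (a i).2) (fun j => (w j).2))) := by
    intro a' w' ha hw
    rw [← hL]
    congr 1
    funext i
    rcases i with i | j
    · exact Prod.ext rfl (ha i).symm
    · exact Prod.ext rfl (hw j).symm
  rw [key a w (fun _ => rfl) (fun _ => rfl), key a z (fun _ => rfl) hwz] at h
  rw [key b w hab (fun _ => rfl), key b z hab hwz]
  have h1 := add_right_cancel (congrArg Prod.fst h)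
  refine congrArg (fun a => Γ.pair (a + c) _) ?_
  -- By additivity of `L` both equalities say that `L` kills a difference of assignments. It is the
  -- same difference: `0` on `X`, and `w - z` in the `A`-coordinates on `Y`.
  rw [← sub_eq_zero, ← map_sub] at h1 ⊢
  rw [← h1]
  congr 1
  funext i
  rcases i with i | j <;> simp

end Extension

theorem IsAbelianExtension.centralizes {Q : Type u} [Loop Q] {A : Subloop Q} {hA : A.IsNormal}
    (h : IsAbelianExtension A hA) :
    (A.con hA).Centralizes (A.con hA) (LoopCon.equality Q) := by
  obtain ⟨hgrp, h⟩ := h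
  let : CommGroup A := hgrp.commGroup
  obtain ⟨Γ, f, -, hf⟩ := h
  -- Compatibility of `f` with cosets makes the second coordinate of `f.symm x` the coset of `x`, so
  -- the congruence of `A` becomes the kernel of the projection.
  have hsnd : ∀ x y, (A.con hA).r x y → (f.symm x).2 = (f.symm y).2 := by
    have hq : ∀ x, (A.con hA).toQuot x = (f.symm x).2 := fun x => by
      conv_lhs => rw [← f.apply_symm_apply x]
      exact hf _ _
    intro x y hxy
    rw [← hq, ← hq]
    exact (LoopCon.toQuot_eq_iff _).2 hxy
  have heval : ∀ (m n : ℕ) (t : LoopTerm (Fin m ⊕ Fin n)) (a : Fin m → Q) (w : Fin n → Q),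
      f.symm (t.eval (Sum.elim a w)) = t.eval (Sum.elim (f.symm ∘ a) (f.symm ∘ w)) := by
    intro m n t a w
    rw [← Sum.comp_elim]
    exact t.map_eval (f.symm : Q →* Γ.Ext) _
  intro m n t a b w z hab hwz e
  apply f.symm.injective
  rw [heval, heval]
  refine Γ.term_condition t (f.symm ∘ a) _ _ _ (fun i => hsnd _ _ (hab i)) (fun j => hsnd _ _ (hwz j)) ?_
  rw [← heval, ← heval]
  exact congrArg f.symm e

end LoopTheory

open LoopTheory
theorem theorem3p1 {Q : Type u} [Loop Q] (A : Subloop Q) (hA : A.IsNormal) :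
    List.TFAE [
      -- (A1)
      A.commutator A hA hA = ⊥,
      -- (A2)
      ∀ (n : ℕ) (W : Word (Fin n)), Word.IsInner.{u} W → ∀ w z : Fin n → Q, (∀ i, w i / z i ∈ A) →
        ∀ a ∈ A, (W.eval w * (W.eval z)⁻¹) a = a,
      -- (A3)
      (∀ φ ∈ inn Q, ∃ ψ : A ≃* A, ∀ a : A, (ψ a : Q) = φ a) ∧
        (∀ a ∈ A, ∀ b ∈ A, ∀ x : Q,
          elemComm a b = 1 ∧ elemAssoc a b x = 1 ∧ elemAssoc a x b = 1 ∧ elemAssoc x a b = 1) ∧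
        (∀ a ∈ A, ∀ x w z : Q, w / z ∈ A → elemAssoc a x w = elemAssoc a x z),
      -- (A4)
      IsAbelianExtension A hA] := by
  rw [Subloop.commutator_eq_bot_iff, ← innerWordsAgree_iff hA]
  tfae_have 1 → 2 := fun h n W hW w z hwz a ha =>
    word_eval_apply_eq_of_centralizes hA h hW hwz ha
  tfae_have 2 → 3 := fun h =>
    ⟨fun φ hφ => exists_mulEquiv_of_inn hA hφ fun a ha b hb => h.inn_map_mul hφ ha hb,
      fun a ha b hb x => ⟨h.elemComm_eq_one ha hb, h.elemAssoc_left_eq_one ha hb x,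
        h.elemAssoc_outer_eq_one ha hb x, h.elemAssoc_right_eq_one ha hb x⟩,
      fun a ha x w z hwz => h.elemAssoc_eq ha (A.div_self_mem x) hwz⟩
  tfae_have 3 → 4 := fun ⟨h1, h2, h3⟩ =>
    isAbelianExtension_of_inn hA h1
      -- The commutator identity does not involve `x`; the value `1` is arbitrary.
      (fun a ha b hb => elemComm_eq_one_iff.1 (h2 a ha b hb 1).1)
      (fun a ha b hb x => elemAssoc_eq_one_iff.1 (h2 a ha b hb x).2.1)
      (fun a ha x w z hwz => by
        -- `elemAssoc a x w` is `innerMapR x w a / a`, so equal associators give equal values of the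
        -- inner mappings.
        have := h3 a ha x w z hwz
        rwa [elemAssoc, Loop.div_eq_iff, elemAssoc, Loop.div_mul] at this)
  tfae_have 4 → 1 := fun h => h.centralizes
  tfae_finish
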